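/- Let $\mathcal M_2^{cm}$ be the set of conjugacy classes $[f,\omega_1,\omega_2]$ of quadratic rational maps $f$ of the Riemann sphere together with an ordering $(\omega_1,\omega_2)$ of their two critical points, where $(f,\omega_1,\omega_2)$ and $(g,\omega_1',\omega_2')$ are conjugate if some Möbius transformation $\gamma$ satisfies $\gamma\circ f=g\circ\gamma$ and $\gamma(\omega_j)=\omega_j'$ for $j=1,2$. For $n\ge 1$ let $X_n$ (respectively $Y_n$) be the set of all $[f,\omega_1,\omega_2]$ for which $\omega_1$ (respectively $\omega_2$) is periodic of period dividing $n$. For $(c,d)\in\mathbb C\times\mathbb C^*$ let $f_{c,d}(z)=1+\frac cz+\frac d{z^2}$, a quadratic rational map with critical points $0$ and $-2d/c$ (the latter meaning $\infty$ if $c=0$). Put $$\mathcal X_n=\{[c:d:1] : c\in\mathbb C,\ d\in\mathbb C^*,\ [f_{c,d},0,-2d/c]\in X_n\},\qquad \mathcal Y_n=\{[c:d:1] : c\in\mathbb C,\ d\in\mathbb C^*,\ [f_{c,d},0,-2d/c]\in Y_n\},$$ and let $\overline{\mathcal X_n}$, $\overline{\mathcal Y_n}$ be their closures in $\mathbb{CP}^2$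 (in the usual topology). The degree of an algebraic curve in $\mathbb{CP}^2$ is the degree of a homogeneous polynomial whose zero set is the curve and which generates the ideal of all polynomials vanishing on it. Then: 1. For all $n\ge 3$, $\overline{\mathcal X_n}$ is an algebraic curve of degree $\frac16 2^n-\frac12-\frac16(-1)^n$. 2. For all $m\ge 1$, $\overline{\mathcal Y_m}$ is an algebraic curve of degree $\frac76 2^m+\frac12-\frac16(-1)^m$. 3. For all $n\ge 3$, none of the points $[1:0:0]$, $[0:1:0]$, $[0:0:1]$ belongs to $\overline{\mathcal X_n}$. -/

import Mathlib

open Polynomial OnePoint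
open scoped LinearAlgebra.Projectivization MatrixGroups

noncomputable section

namespace QuadRat

/-- The self-map of the Riemann sphere given by `z ↦ p(z) / q(z)`, for coprime polynomials
`p`, `q` with `max (deg p) (deg q) = 2`. -/
def sphereMap (p q : ℂ[X]) (x : OnePoint ℂ) : OnePoint ℂ :=
  x.elim
    (if q.coeff 2 = 0 then ∞ else ((p.coeff 2 / q.coeff 2 : ℂ) : OnePoint ℂ))
    (fun z => if q.eval z = 0 then ∞ else ((p.eval z / q.eval z : ℂ) : OnePoint ℂ))

/-- Critical points of the quadratic rational map `p / q`: the zeros on the sphere of the Wronskian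
`p q' - p' q`, regarded as a binary form of degree `2`; so `∞` is a zero exactly when
the coefficient of `X ^ 2` vanishes. -/
def IsCritical (p q : ℂ[X]) (x : OnePoint ℂ) : Prop :=
  x.elim ((wronskian p q).coeff 2 = 0) (fun z => (wronskian p q).eval z = 0)

/-- A critically marked quadratic rational map `(f, ω₁, ω₂)`: `f = num / den` has degree two and
`ω₁`, `ω₂` are its two critical points, in this order. -/
structure MarkedMap where
  num : ℂ[X]
  den : ℂ[X]
  coprime : IsCoprime num den
  degree_eq : max num.natDegree den.natDegree = 2
  ω₁ : OnePoint ℂ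
  ω₂ : OnePoint ℂ
  critical₁ : IsCritical num den ω₁
  critical₂ : IsCritical num den ω₂
  ne : ω₁ ≠ ω₂

/-- The underlying map of the Riemann sphere. -/
def MarkedMap.toFun (F : MarkedMap) : OnePoint ℂ → OnePoint ℂ := sphereMap F.num F.den

/-- Conjugacy by a Möbius transformation respecting the marking. -/
def Conj (F G : MarkedMap) : Prop :=
  ∃ γ : GL (Fin 2) ℂ, (∀ x, γ • F.toFun x = G.toFun (γ • x)) ∧ γ • F.ω₁ = G.ω₁ ∧ γ • F.ω₂ = G.ω₂

theorem conj_equivalence : Equivalence Conj where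
  refl F := ⟨1, by simp⟩
  symm := by
    rintro F G ⟨γ, h, h₁, h₂⟩
    refine ⟨γ⁻¹, fun x => ?_, by simp [← h₁], by simp [← h₂]⟩
    rw [inv_smul_eq_iff, h, smul_inv_smul]
  trans := by
    rintro F G H ⟨γ, h, h₁, h₂⟩ ⟨δ, k, k₁, k₂⟩
    refine ⟨δ * γ, fun x => ?_, by rw [mul_smul, h₁, k₁], by rw [mul_smul, h₂, k₂]⟩
    rw [mul_smul, h, k, mul_smul]

instance markedSetoid : Setoid MarkedMap := ⟨Conj, conj_equivalence⟩

/-- The moduli space of critically marked quadratic rational maps (as a set). -/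
def Moduli : Type := Quotient markedSetoid

/-- The conjugacy class `[f, ω₁, ω₂]`. -/
def MarkedMap.cls (F : MarkedMap) : Moduli := Quotient.mk markedSetoid F

/-- Classes `[f, ω₁, ω₂]` such that `ω₁` is periodic of period exactly `p` (for `p ≥ 1`). -/
def V (p : ℕ) : Set Moduli :=
  {x | ∃ F : MarkedMap, F.cls = x ∧ Function.minimalPeriod F.toFun F.ω₁ = p}

/-- Classes `[f, ω₁, ω₂]` such that `ω₂` is periodic of period exactly `p` (for `p ≥ 1`). -/
def W (p : ℕ) : Set Moduli :=
  {x | ∃ F : MarkedMap, F.cls = x ∧ Function.minimalPeriod F.toFun F.ω₂ = p}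

/-- The set `X_n` of classes for which `ω₁` is periodic of period dividing `n`. -/
def X (n : ℕ) : Set Moduli := ⋃ p ∈ n.divisors, V p

/-- The set `Y_m` of classes for which `ω₂` is periodic of period dividing `m`. -/
def Y (m : ℕ) : Set Moduli := ⋃ p ∈ m.divisors, W p

/-- The marked map `(f_{c,d}, 0, -2d/c)` with `f_{c,d}(z) = 1 + c/z + d/z²` and `d ≠ 0`; when
`c = 0` the second critical point is `∞`. -/
def family (c d : ℂ) (hd : d ≠ 0) : MarkedMap where
  num := Polynomial.X ^ 2 + C c * Polynomial.X + C d
  den := Polynomial.X ^ 2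
  coprime := by
    refine IsCoprime.pow_right ?_
    refine ⟨C d⁻¹, -C d⁻¹ * (Polynomial.X + C c), ?_⟩
    have : (C d⁻¹ * C d : ℂ[X]) = 1 := by rw [← C_mul, inv_mul_cancel₀ hd, C_1]
    linear_combination this
  degree_eq := by
    have : (Polynomial.X ^ 2 + C c * Polynomial.X + C d : ℂ[X]).natDegree = 2 := by compute_degree!
    rw [this]; simp
  ω₁ := ((0 : ℂ) : OnePoint ℂ)
  ω₂ := if c = 0 then ∞ else ((-2 * d / c : ℂ) : OnePoint ℂ)
  critical₁ := by simp [IsCritical, wronskian]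
  critical₂ := by
    have hw : wronskian (Polynomial.X ^ 2 + C c * Polynomial.X + C d : ℂ[X]) (Polynomial.X ^ 2)
        = C c * Polynomial.X ^ 2 + C (2 * d) * Polynomial.X := by
      simp [wronskian, C_ofNat]; ring
    unfold IsCritical
    rw [hw]
    split_ifs with hc
    · simp [hc]
    · simp only [OnePoint.elim_some, eval_add, eval_mul, eval_C, eval_pow, eval_X]
      field_simp
      ring
  ne := by
    split_ifs with hc
    · exact OnePoint.coe_ne_infty _
    · intro h
      have h' := (OnePoint.coe_injective h).symm
      exact div_ne_zero (mul_ne_zero (by norm_num) hd) hc h'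

/-- The complex projective plane, with homogeneous coordinates `[c : d : e]`. -/
abbrev CP2 : Type := ℙ ℂ (Fin 3 → ℂ)

/-- The usual topology of the projective plane: the quotient topology. -/
instance : TopologicalSpace CP2 :=
  TopologicalSpace.coinduced
    (fun v : {v : Fin 3 → ℂ // v ≠ 0} => Projectivization.mk ℂ v.1 v.2) inferInstance

/-- The point `[c : d : 1]` of the affine chart. -/
def affinePoint (c d : ℂ) : CP2 :=
  Projectivization.mk ℂ ![c, d, 1] (fun h => one_ne_zero (congrFun h 2))

/-- The part of a subset of the moduli space that lies in the family `(f_{c,d}, 0, -2d/c)`, `d ≠ 0`,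
seen in the projective plane through `(c, d) ↦ [c : d : 1]`. -/
def trace (S : Set Moduli) : Set CP2 :=
  {x | ∃ (c d : ℂ) (hd : d ≠ 0), (family c d hd).cls ∈ S ∧ x = affinePoint c d}

/-- The affine cone, without the origin, over a subset of the projective plane. -/
def cone (Z : Set CP2) : Set (Fin 3 → ℂ) :=
  {v | ∃ hv : v ≠ 0, Projectivization.mk ℂ v hv ∈ Z}

/-- `Z` is an algebraic curve in the projective plane of degree `k`: it is the zero set of a nonzero
homogeneous polynomial of degree `k` that generates the ideal of all polynomials vanishing
on (the cone over) `Z`. -/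
def IsCurveOfDegree (Z : Set CP2) (k : ℕ) : Prop :=
  ∃ F : MvPolynomial (Fin 3) ℂ, F ≠ 0 ∧ F.IsHomogeneous k ∧
    (∀ (v : Fin 3 → ℂ) (hv : v ≠ 0), Projectivization.mk ℂ v hv ∈ Z ↔ MvPolynomial.eval v F = 0) ∧
    MvPolynomial.vanishingIdeal ℂ (cone Z) = Ideal.span {F}

end QuadRat

end

/-! Write `c = 2a` and follow the critical orbits in homogeneous coordinates `[q : r]`. Since `0 ↦ ∞
↦ 1`, periodicity of `0` says that some `q` in the orbit of `[1 : 1]` vanishes; periodicity of the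
other critical point `-d/a` is a similar equation on the orbit of its critical value `(d - a²)/d`.
Inserting a power of `e` that alternates with the parity of the step makes these equations forms in
`(a, d, e)`, and the degree recursion `orbDeg` gives the stated numbers.

It remains to see that the closure of the locus is the whole zero set of the form `F`, and that `F`
generates the ideal. For the first, `F` does not vanish at `[1 : 0 : 0]` (a positivity argument over
`ℝ`), so it has no component inside `d = 0` or `e = 0`, and zeros off these lines are dense
(`mem_closure_zeros`). For the second, by the Nullstellensatz, `F` must be square-free.

Square-freeness is proved modulo `2`, where the cross term `2aqr` disappears and all squares have
derivative zero. One partial derivative of the form then reduces to a simple expression in a single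
orbit coordinate, and coprimality of the coordinates (`orb_coprime`) excludes a common factor. A
valuation ring of `ℂ` with residue characteristic `2` lifts the result (`squarefree_of_residue`).
The change `c = 2a` is invertible over `ℂ`, hence harmless. -/

noncomputable section

namespace QuadRat

/-! ### Homogeneous orbit recursion -/

section Orbit

variable {R S : Type*} [CommRing R] [CommRing S]

/-- One step of `z ↦ 1 + 2a/z + d/z²` in the homogeneous coordinates `z = q / r`, made homogeneous
in `(a, d, e)` too; the power of `e` to be inserted depends on the parity of `n`. -/
def step (a d e : R) (n : ℕ) (s : R × R) : R × R :=
  if Even n then (e * s.1 ^ 2 + 2 * a * s.1 * s.2 + d * s.2 ^ 2, s.1 ^ 2)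
  else (s.1 ^ 2 + 2 * a * s.1 * s.2 + e * d * s.2 ^ 2, s.1 ^ 2)

/-- The orbit of `s` under `step`, where `b` is the parity of the first step. -/
def orb (a d e : R) (b : ℕ) (s : R × R) : ℕ → R × R
  | 0 => s
  | k + 1 => step a d e (k + b) (orb a d e b s k)

theorem map_orb (φ : R →+* S) (a d e : R) (b : ℕ) (s : R × R) (k : ℕ) :
    Prod.map φ φ (orb a d e b s k) = orb (φ a) (φ d) (φ e) b (Prod.map φ φ s) k := by
  induction k with
  | zero => rfl
  | succ k ih =>
    rw [orb, orb, ← ih]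
    unfold step
    split_ifs <;> simp [map_ofNat φ 2]

/-- The form whose zeros with `e = 1` are the parameters with `0` of period dividing `k + 2`. -/
def formX (a d e : R) (k : ℕ) : R := (orb a d e 0 (1, 1) k).1

/-- The orbit of the second critical value. -/
def orbY (a d e : R) (k : ℕ) : R × R := orb a d e 1 (d * e - a ^ 2, d) k

/-- The form whose zeros with `e = 1` are the parameters for which the second critical point
has period dividing `k + 1`. -/
def formY (a d e : R) (k : ℕ) : R :=
  if Even k then a * (orbY a d e k).1 + d * e * (orbY a d e k).2
  else a * (orbY a d e k).1 + d * (orbY a d e k).2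

theorem map_formX (φ : R →+* S) (a d e : R) (k : ℕ) :
    φ (formX a d e k) = formX (φ a) (φ d) (φ e) k := by
  have := congrArg Prod.fst (map_orb φ a d e 0 (1, 1) k)
  simpa [formX] using this

theorem map_orbY (φ : R →+* S) (a d e : R) (k : ℕ) :
    Prod.map φ φ (orbY a d e k) = orbY (φ a) (φ d) (φ e) k := by
  simp [orbY, map_orb]

theorem map_formY (φ : R →+* S) (a d e : R) (k : ℕ) :
    φ (formY a d e k) = formY (φ a) (φ d) (φ e) k := by
  unfold formY
  rw [← map_orbY]
  split_ifs <;> simp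

/-- The degrees of the first coordinates of an orbit of `step`. -/
def orbDeg (b g : ℕ) : ℕ → ℕ
  | 0 => g
  | k + 1 => if Even (k + b) then 2 * orbDeg b g k + 1 else 2 * orbDeg b g k

/-- The invariant is that `q` and `r` have equal degree before an even step, while `q` has degree
one more before an odd step. The factors of `e` in `step` are exactly those needed to balance the
three terms in each case. -/
theorem orb_isHomogeneous {σ : Type*} {a d e : MvPolynomial σ R} (ha : a.IsHomogeneous 1)
    (hd : d.IsHomogeneous 1) (he : e.IsHomogeneous 1) (b g h : ℕ)
    (s : MvPolynomial σ R × MvPolynomial σ R) (h₁ : s.1.IsHomogeneous g) (h₂ : s.2.IsHomogeneous h)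
    (hg : g = if Even b then h else h + 1) (k : ℕ) :
    (orb a d e b s k).1.IsHomogeneous (orbDeg b g k) ∧
      ∃ l, (orb a d e b s k).2.IsHomogeneous l ∧
        orbDeg b g k = if Even (k + b) then l else l + 1 := by
  induction k with
  | zero => exact ⟨h₁, h, h₂, by simpa [orbDeg] using hg⟩
  | succ k ih =>
    obtain ⟨i₁, l, i₂, i₃⟩ := ih
    have h2 : (2 : MvPolynomial σ R).IsHomogeneous 0 := by
      exact map_ofNat (MvPolynomial.C (σ := σ) (R := R)) 2 ▸ MvPolynomial.isHomogeneous_C σ (2 : R)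
    have hpar : Even (k + 1 + b) ↔ ¬ Even (k + b) := by
      rw [add_right_comm, Nat.even_add_one]
    simp only [orb, orbDeg, step, hpar]
    by_cases hk : Even (k + b)
    · simp only [hk, if_true, not_true, if_false] at i₃ ⊢
      refine ⟨?_, _, i₁.pow 2, by ring⟩
      refine (MvPolynomial.IsHomogeneous.add ?_ ?_).add ?_
      · convert he.mul (i₁.pow 2) using 1; ring
      · convert ((h2.mul ha).mul i₁).mul i₂ using 1; omega
      · convert hd.mul (i₂.pow 2) using 1; omega
    · simp only [hk, if_true, not_false_iff, if_false] at i₃ ⊢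
      refine ⟨?_, _, i₁.pow 2, by ring⟩
      refine (MvPolynomial.IsHomogeneous.add ?_ ?_).add ?_
      · convert i₁.pow 2 using 1; ring
      · convert ((h2.mul ha).mul i₁).mul i₂ using 1; omega
      · convert (he.mul hd).mul (i₂.pow 2) using 1; omega

theorem formX_isHomogeneous {σ : Type*} {a d e : MvPolynomial σ R} (ha : a.IsHomogeneous 1)
    (hd : d.IsHomogeneous 1) (he : e.IsHomogeneous 1) (k : ℕ) :
    (formX a d e k).IsHomogeneous (orbDeg 0 0 k) :=
  (orb_isHomogeneous ha hd he 0 0 0 (1, 1) (MvPolynomial.isHomogeneous_one _ _)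
    (MvPolynomial.isHomogeneous_one _ _) (by simp) k).1

theorem formY_isHomogeneous {σ : Type*} {a d e : MvPolynomial σ R} (ha : a.IsHomogeneous 1)
    (hd : d.IsHomogeneous 1) (he : e.IsHomogeneous 1) (k : ℕ) :
    (formY a d e k).IsHomogeneous (orbDeg 1 2 k + 1) := by
  obtain ⟨h₁, l, h₂, h₃⟩ := orb_isHomogeneous ha hd he 1 2 1 (d * e - a ^ 2, d)
    ((hd.mul he).sub (ha.pow 2)) hd (by simp) k
  simp only [Nat.even_add_one] at h₃
  unfold formY orbY
  split_ifs with hk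
  · simp only [hk, not_true, if_false] at h₃
    refine MvPolynomial.IsHomogeneous.add ?_ ?_
    · convert ha.mul h₁ using 1; ring
    · convert (hd.mul he).mul h₂ using 1; omega
  · simp only [hk, not_false_iff, if_true] at h₃
    refine MvPolynomial.IsHomogeneous.add ?_ ?_
    · convert ha.mul h₁ using 1; ring
    · convert hd.mul h₂ using 1; omega

theorem orbDeg_zero_zero (k : ℕ) :
    (orbDeg 0 0 k : ℚ) = 1 / 6 * 2 ^ (k + 2) - 1 / 2 - 1 / 6 * (-1) ^ (k + 2) := by
  induction k with
  | zero => norm_num [orbDeg]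
  | succ k ih =>
    simp only [orbDeg, add_zero]
    split_ifs with hk
    · push_cast; rw [ih]; simp only [pow_succ, hk.neg_one_pow]; ring
    · push_cast; rw [ih]; simp only [pow_succ, (Nat.not_even_iff_odd.1 hk).neg_one_pow]; ring

theorem orbDeg_one_two (k : ℕ) :
    ((orbDeg 1 2 k + 1 : ℕ) : ℚ) = 7 / 6 * 2 ^ (k + 1) + 1 / 2 - 1 / 6 * (-1) ^ (k + 1) := by
  induction k with
  | zero => norm_num [orbDeg]
  | succ k ih =>
    simp only [orbDeg, Nat.even_add_one]
    push_cast at ih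
    split_ifs with hk
    · push_cast
      rw [eq_sub_of_add_eq ih]
      simp only [pow_succ, hk.neg_one_pow]; ring
    · push_cast
      rw [eq_sub_of_add_eq ih]
      simp only [pow_succ, (Nat.not_even_iff_odd.1 hk).neg_one_pow]; ring

/-! ### Values of the forms at the coordinate points -/

theorem formX_zero_one_zero (k : ℕ) : formX (0 : R) 1 0 k = 1 := by
  have (k : ℕ) : orb (0 : R) 1 0 0 (1, 1) k = (1, 1) := by
    induction k with
    | zero => rfl
    | succ k ih => simp [orb, step, ih]
  simp [formX, this]

theorem formX_apply_zero_one (a : R) (h : a = 0 ∨ (2 : R) = 0) (k : ℕ) : formX a 0 1 k = 1 := by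
  have (k : ℕ) : orb a 0 1 0 (1, 1) k = (1, 1) := by
    induction k with
    | zero => rfl
    | succ k ih =>
      rw [orb, ih]
      rcases h with h | h <;> simp [step, h]
  simp [formX, this]

/-- With `d = e = 0` a step only adds and multiplies nonnegative terms, at least one of them
positive. This gives nonvanishing at `[1 : 0 : 0]`. -/
theorem formX_pos {a : ℝ} (ha : 0 < a) (k : ℕ) : 0 < formX a 0 0 (k + 1) := by
  have : 0 < (orb a 0 0 0 (1, 1) (k + 1)).1 ∧ 0 < (orb a 0 0 0 (1, 1) (k + 1)).2 := by
    induction k with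
    | zero => simp [orb, step, ha]
    | succ k ih =>
      obtain ⟨h₁, h₂⟩ := ih
      rw [orb]; unfold step
      split_ifs <;> exact ⟨by simp only [zero_mul, add_zero, zero_add]; positivity, by positivity⟩
  exact this.1

theorem formY_ne_zero {a : ℝ} (ha : 0 < a) (k : ℕ) : formY a 0 0 k ≠ 0 := by
  have (k : ℕ) : 0 < (orbY a 0 0 (k + 1)).1 ∧ 0 < (orbY a 0 0 (k + 1)).2 := by
    induction k with
    | zero => simp [orbY, orb, step]; positivity
    | succ k ih =>
      obtain ⟨h₁, h₂⟩ := ih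
      unfold orbY at h₁ h₂ ⊢
      rw [orb]
      generalize orb a 0 0 1 (0 * 0 - a ^ 2, 0) (k + 1) = s at h₁ h₂ ⊢
      unfold step
      split_ifs <;> exact ⟨by simp only [zero_mul, add_zero, zero_add]; positivity, by positivity⟩
  -- The initial pair is `(-a², 0)`, so positivity only begins after one step; `k = 0` gives `-a³`.
  cases k with
  | zero => simp [formY, orbY, orb, ha.ne']
  | succ k => simp [formY, ha.ne', (this k).1.ne']

end Orbit

/-! ### Dynamics -/

/-- The point of the sphere with homogeneous coordinates `[x : y]`. -/
def toSphere (s : ℂ × ℂ) : OnePoint ℂ := if s.2 = 0 then ∞ else ((s.1 / s.2 : ℂ) : OnePoint ℂ)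

theorem toSphere_eq_iff {s t : ℂ × ℂ} (hs : s ≠ 0) (ht : t ≠ 0) :
    toSphere s = toSphere t ↔ s.1 * t.2 = t.1 * s.2 := by
  obtain ⟨x, y⟩ := s
  obtain ⟨u, v⟩ := t
  unfold toSphere
  by_cases hy : y = 0 <;> by_cases hv : v = 0 <;> simp [hy, hv] at hs ht ⊢
  · exact hs
  · exact ht
  · rw [div_eq_div_iff hy hv]

theorem step_ne_zero {a d : ℂ} (hd : d ≠ 0) (n : ℕ) {s : ℂ × ℂ} (hs : s ≠ 0) :
    step a d 1 n s ≠ 0 := by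
  obtain ⟨x, y⟩ := s
  intro h
  have h₁ : x ^ 2 + 2 * a * x * y + d * y ^ 2 = 0 ∧ x = 0 := by
    unfold step at h
    split_ifs at h <;> simpa using h
  obtain ⟨h₁, rfl⟩ := h₁
  simp [hd] at h₁
  exact hs (by simp [h₁])

theorem toFun_toSphere {a d : ℂ} (hd : d ≠ 0) (n : ℕ) {s : ℂ × ℂ} (hs : s ≠ 0) :
    (family (2 * a) d hd).toFun (toSphere s) = toSphere (step a d 1 n s) := by
  obtain ⟨x, y⟩ := s
  have hst : step a d 1 n (x, y) = (x ^ 2 + 2 * a * x * y + d * y ^ 2, x ^ 2) := by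
    unfold step; split_ifs <;> simp
  rw [hst]
  by_cases hy : y = 0
  · subst hy
    have hx : x ≠ 0 := by simpa using hs
    simp only [toSphere, MarkedMap.toFun, family, sphereMap, if_true, OnePoint.elim_infty]
    simp [hx]
  · simp only [toSphere, MarkedMap.toFun, family, sphereMap, hy, if_false, OnePoint.elim_some]
    by_cases hx : x = 0
    · simp [hx]
    · simp [hx, hy]
      field_simp

theorem iterate_toFun_toSphere {a d : ℂ} (hd : d ≠ 0) (b : ℕ) {s : ℂ × ℂ} (hs : s ≠ 0) (k : ℕ) :
    orb a d 1 b s k ≠ 0 ∧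
      (family (2 * a) d hd).toFun^[k] (toSphere s) = toSphere (orb a d 1 b s k) := by
  induction k with
  | zero => exact ⟨hs, rfl⟩
  | succ k ih =>
    exact ⟨step_ne_zero hd _ ih.1, by
      rw [Function.iterate_succ_apply', ih.2, orb, toFun_toSphere hd (k + b) ih.1]⟩

/-! ### Periodicity of critical points on conjugacy classes -/

theorem Conj.semiconj_iterate {F G : MarkedMap} {γ : GL (Fin 2) ℂ}
    (h : ∀ x, γ • F.toFun x = G.toFun (γ • x)) (n : ℕ) (x : OnePoint ℂ) :
    γ • F.toFun^[n] x = G.toFun^[n] (γ • x) :=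
  (Function.Semiconj.iterate_right (f := (γ • ·)) h n) x

theorem Conj.isPeriodicPt {F G : MarkedMap} (h : Conj F G) (n : ℕ) :
    (Function.IsPeriodicPt F.toFun n F.ω₁ → Function.IsPeriodicPt G.toFun n G.ω₁) ∧
      (Function.IsPeriodicPt F.toFun n F.ω₂ → Function.IsPeriodicPt G.toFun n G.ω₂) := by
  obtain ⟨γ, h, h₁, h₂⟩ := h
  refine ⟨fun hp => ?_, fun hp => ?_⟩
  · rw [Function.IsPeriodicPt, Function.IsFixedPt, ← h₁, ← Conj.semiconj_iterate h, hp]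
  · rw [Function.IsPeriodicPt, Function.IsFixedPt, ← h₂, ← Conj.semiconj_iterate h, hp]

theorem cls_mem_X {F : MarkedMap} {n : ℕ} (hn : n ≠ 0) :
    F.cls ∈ X n ↔ Function.IsPeriodicPt F.toFun n F.ω₁ := by
  simp only [X, V, Set.mem_iUnion, Set.mem_ofPred_eq, Nat.mem_divisors]
  constructor
  · rintro ⟨p, ⟨hp, -⟩, G, hG, rfl⟩
    exact ((Quotient.exact hG : Conj G F).isPeriodicPt n).1
      (Function.isPeriodicPt_iff_minimalPeriod_dvd.2 hp)
  · exact fun h => ⟨_, ⟨h.minimalPeriod_dvd, hn⟩, F, rfl, rfl⟩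

theorem cls_mem_Y {F : MarkedMap} {n : ℕ} (hn : n ≠ 0) :
    F.cls ∈ Y n ↔ Function.IsPeriodicPt F.toFun n F.ω₂ := by
  simp only [Y, W, Set.mem_iUnion, Set.mem_ofPred_eq, Nat.mem_divisors]
  constructor
  · rintro ⟨p, ⟨hp, -⟩, G, hG, rfl⟩
    exact ((Quotient.exact hG : Conj G F).isPeriodicPt n).2
      (Function.isPeriodicPt_iff_minimalPeriod_dvd.2 hp)
  · exact fun h => ⟨_, ⟨h.minimalPeriod_dvd, hn⟩, F, rfl, rfl⟩

theorem family_mem_X {a d : ℂ} (hd : d ≠ 0) (k : ℕ) :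
    (family (2 * a) d hd).cls ∈ X (k + 2) ↔ formX a d 1 k = 0 := by
  rw [cls_mem_X (by omega), Function.IsPeriodicPt, Function.IsFixedPt]
  have h0 : (family (2 * a) d hd).ω₁ = toSphere (0, 1) := by simp [family, toSphere]
  have h1 : ((0, 1) : ℂ × ℂ) ≠ 0 := by simp
  have h2 : ((d, 0) : ℂ × ℂ) ≠ 0 := by simp [hd]
  have h3 : ((1, 1) : ℂ × ℂ) ≠ 0 := by simp
  -- The two steps `0 ↦ ∞ ↦ 1` account for the shift between `k` and the period `k + 2`.
  have e1 : (family (2 * a) d hd).toFun (toSphere (0, 1)) = toSphere (d, 0) := by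
    rw [toFun_toSphere hd 0 h1]; simp [step]
  have e2 : (family (2 * a) d hd).toFun (toSphere (d, 0)) = toSphere (1, 1) := by
    rw [toFun_toSphere hd 0 h2]; simp [step, toSphere, hd]
  obtain ⟨i₁, i₂⟩ := iterate_toFun_toSphere (a := a) hd 0 h3 k
  rw [h0, Function.iterate_add_apply, Function.iterate_succ_apply, Function.iterate_one, e1, e2, i₂,
    toSphere_eq_iff i₁ h1]
  simp [formX]

theorem family_mem_Y {a d : ℂ} (hd : d ≠ 0) (k : ℕ) :
    (family (2 * a) d hd).cls ∈ Y (k + 1) ↔ formY a d 1 k = 0 := by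
  rw [cls_mem_Y (by omega), Function.IsPeriodicPt, Function.IsFixedPt]
  have h1 : ((-d, a) : ℂ × ℂ) ≠ 0 := by simp [hd]
  have h0 : (family (2 * a) d hd).ω₂ = toSphere (-d, a) := by
    by_cases ha : a = 0
    · simp [family, toSphere, ha]
    · simp only [family, toSphere, ha, mul_eq_zero, two_ne_zero, false_or, if_false,
        OnePoint.coe_eq_coe]
      field_simp
  have h2 : ((d * 1 - a ^ 2, d) : ℂ × ℂ) ≠ 0 := by simp [hd]
  have e1 : (family (2 * a) d hd).toFun (toSphere (-d, a)) = toSphere (d * 1 - a ^ 2, d) := by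
    rw [toFun_toSphere hd 0 h1, toSphere_eq_iff (step_ne_zero hd 0 h1) h2]
    simp [step]
    ring
  obtain ⟨i₁, i₂⟩ := iterate_toFun_toSphere (a := a) hd 1 h2 k
  rw [h0, Function.iterate_succ_apply, e1, i₂, toSphere_eq_iff i₁ h1]
  have : formY a d 1 k = a * (orbY a d 1 k).1 + d * (orbY a d 1 k).2 := by
    unfold formY; split_ifs <;> simp
  rw [this, ← orbY]
  constructor <;> intro h <;> linear_combination h


/-! ### Square-freeness in characteristic two -/

section CharTwo

open MvPolynomial

variable {k : Type*} [Field k]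

theorem not_dvd_of_dvd_X {σ : Type*} {p F : MvPolynomial σ k} (hp : Irreducible p) {i : σ}
    (hi : p ∣ MvPolynomial.X i) {v : σ → k} (hv : v i = 0) (hF : eval v F ≠ 0) : ¬ p ∣ F := by
  intro h
  have ha : Associated p (MvPolynomial.X i) :=
    hp.associated_of_dvd MvPolynomial.X_prime.irreducible hi
  obtain ⟨G, rfl⟩ := ha.symm.dvd.trans h
  simp [hv] at hF

/-- A polynomial which has no irreducible factor in common with a derivative is square-free. -/
theorem squarefree_of_pderiv {σ : Type*} {F : MvPolynomial σ k} (hF : F ≠ 0) (i : σ)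
    (h : ∀ p, Irreducible p → p ∣ F → ¬ p ∣ pderiv i F) : Squarefree F := by
  rw [squarefree_iff_irreducible_sq_not_dvd_of_ne_zero hF]
  rintro p hp ⟨G, rfl⟩
  refine h p hp ⟨p * G, by ring⟩ ?_
  rw [Derivation.leibniz, Derivation.leibniz]
  simp only [smul_eq_mul]
  exact ⟨p * pderiv i G + 2 * G * pderiv i p, by ring⟩

theorem pderiv_sq (h2 : (2 : k) = 0) {σ : Type*} (i : σ) (F : MvPolynomial σ k) :
    pderiv i (F ^ 2) = 0 := by
  have : (2 : MvPolynomial σ k) = 0 := by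
    rw [← map_ofNat (C : k →+* MvPolynomial σ k) 2, h2, map_zero]
  rw [sq, Derivation.leibniz, smul_eq_mul, ← two_mul, this, zero_mul]

theorem step_of_two_eq_zero (h2 : (2 : k) = 0) {σ : Type*} (a d e : MvPolynomial σ k) (n : ℕ)
    (s : MvPolynomial σ k × MvPolynomial σ k) :
    step a d e n s = if Even n then (e * s.1 ^ 2 + d * s.2 ^ 2, s.1 ^ 2)
      else (s.1 ^ 2 + e * d * s.2 ^ 2, s.1 ^ 2) := by
  have : (2 : MvPolynomial σ k) = 0 := by
    rw [← map_ofNat (C : k →+* MvPolynomial σ k) 2, h2, map_zero]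
  simp [step, this]

local notation "𝐚" => (MvPolynomial.X 0 : MvPolynomial (Fin 3) k)
local notation "𝐝" => (MvPolynomial.X 1 : MvPolynomial (Fin 3) k)
local notation "𝐞" => (MvPolynomial.X 2 : MvPolynomial (Fin 3) k)

/-- These two points lie on `d = 0` and `e = 0` respectively, so the values `1` show that neither
`d` nor `e` divides the first coordinate of the orbit. -/
theorem eval_orb (h2 : (2 : k) = 0) (b : ℕ) {s : MvPolynomial (Fin 3) k × MvPolynomial (Fin 3) k}
    (h₁ : eval ![1, 0, 1] s.1 = 1) (h₂ : eval ![1, 1, 0] s.1 = 1 ∧ eval ![1, 1, 0] s.2 = 1)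
    (j : ℕ) : eval ![1, 0, 1] (orb 𝐚 𝐝 𝐞 b s j).1 = 1 ∧ eval ![1, 1, 0] (orb 𝐚 𝐝 𝐞 b s j).1 = 1 ∧
      eval ![1, 1, 0] (orb 𝐚 𝐝 𝐞 b s j).2 = 1 := by
  induction j with
  | zero => exact ⟨h₁, h₂⟩
  | succ j ih =>
    rw [orb, step_of_two_eq_zero h2]
    split_ifs <;> simp [ih]

/-- Descent: as the new `r` is the old `q²`, a common factor of both new coordinates divides the old
`q`, hence `d r²` or `e d r²`. It does not divide `d` or `e`, so it divides the old `r`, and so on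
back to the initial pair. -/
theorem orb_coprime (h2 : (2 : k) = 0) (b : ℕ)
    {s : MvPolynomial (Fin 3) k × MvPolynomial (Fin 3) k}
    (h₁ : eval ![1, 0, 1] s.1 = 1) (h₂ : eval ![1, 1, 0] s.1 = 1 ∧ eval ![1, 1, 0] s.2 = 1)
    {p : MvPolynomial (Fin 3) k} (hp : Irreducible p) (h : p ∣ s.1 → ¬ p ∣ s.2) (j : ℕ)
    (hj : p ∣ (orb 𝐚 𝐝 𝐞 b s j).1) :
    ¬ p ∣ 𝐝 ∧ ¬ p ∣ 𝐞 ∧ ¬ p ∣ (orb 𝐚 𝐝 𝐞 b s j).2 := by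
  have hprime := hp.prime
  have hd (j) (hj : p ∣ (orb 𝐚 𝐝 𝐞 b s j).1) : ¬ p ∣ 𝐝 := fun hd =>
    not_dvd_of_dvd_X hp hd (v := ![1, 0, 1]) (by simp)
      (by rw [(eval_orb h2 b h₁ h₂ j).1]; exact one_ne_zero) hj
  have he (j) (hj : p ∣ (orb 𝐚 𝐝 𝐞 b s j).1) : ¬ p ∣ 𝐞 := fun he =>
    not_dvd_of_dvd_X hp he (v := ![1, 1, 0]) (by simp)
      (by rw [(eval_orb h2 b h₁ h₂ j).2.1]; exact one_ne_zero) hj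
  refine ⟨hd j hj, he j hj, ?_⟩
  induction j with
  | zero => exact h hj
  | succ j ih =>
    intro hr
    have hr' : p ∣ (orb 𝐚 𝐝 𝐞 b s j).1 := by
      refine hprime.dvd_of_dvd_pow (n := 2) ?_
      rw [orb, step_of_two_eq_zero h2] at hr
      split_ifs at hr <;> exact hr
    rw [orb, step_of_two_eq_zero h2] at hj
    have hsq : p ∣ (orb 𝐚 𝐝 𝐞 b s j).1 ^ 2 := dvd_pow hr' two_ne_zero
    split_ifs at hj
    · rcases hprime.dvd_or_dvd ((dvd_add_right (hsq.mul_left _)).1 hj) with h | h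
      · exact hd j hr' h
      · exact ih hr' (hprime.dvd_of_dvd_pow h)
    · rcases hprime.dvd_or_dvd ((dvd_add_right hsq).1 hj) with h | h
      · exact (hprime.dvd_or_dvd h).elim (he j hr') (hd j hr')
      · exact ih hr' (hprime.dvd_of_dvd_pow h)

theorem formX_ne_zero_of_two_eq_zero (h2 : (2 : k) = 0) (j : ℕ) : formX 𝐚 𝐝 𝐞 j ≠ 0 := fun h => by
  have := (eval_orb h2 0 (s := (1, 1)) (by simp) (by simp) j).1
  rw [← formX, h, map_zero] at this
  exact zero_ne_one this

/-- Differentiate the last step in `d`: since squares have derivative zero, only `r²` or `e r²`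
survives. A repeated factor would divide `r`, hence also `q`, of the preceding orbit point. -/
theorem formX_squarefree (h2 : (2 : k) = 0) (j : ℕ) : Squarefree (formX 𝐚 𝐝 𝐞 (j + 1)) := by
  refine squarefree_of_pderiv (formX_ne_zero_of_two_eq_zero h2 _) 1 fun p hp h h' => ?_
  have hprime := hp.prime
  obtain ⟨-, he, -⟩ := orb_coprime h2 0 (s := (1, 1)) (by simp) (by simp) hp
    (fun h _ => hp.not_isUnit (isUnit_of_dvd_one h)) (j + 1) h
  have h1 : pderiv 1 𝐞 = 0 := pderiv_X_of_ne (by decide)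
  have key : pderiv 1 (formX 𝐚 𝐝 𝐞 (j + 1)) = (orb 𝐚 𝐝 𝐞 0 (1, 1) j).2 ^ 2 ∨
      pderiv 1 (formX 𝐚 𝐝 𝐞 (j + 1)) = 𝐞 * (orb 𝐚 𝐝 𝐞 0 (1, 1) j).2 ^ 2 := by
    rw [formX, orb, step_of_two_eq_zero h2]
    split_ifs
    · exact Or.inl (by simp [pderiv_sq h2, Derivation.leibniz, h1])
    · exact Or.inr (by simp [pderiv_sq h2, Derivation.leibniz, h1, mul_comm])
  have hr' : p ∣ (orb 𝐚 𝐝 𝐞 0 (1, 1) j).2 := by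
    rcases key with key | key <;> rw [key] at h'
    · exact hprime.dvd_of_dvd_pow h'
    · exact hprime.dvd_of_dvd_pow ((hprime.dvd_or_dvd h').resolve_left he)
  have hq : p ∣ (orb 𝐚 𝐝 𝐞 0 (1, 1) j).1 := by
    refine hprime.dvd_of_dvd_pow (n := 2) ?_
    have hsq : p ∣ (orb 𝐚 𝐝 𝐞 0 (1, 1) j).2 ^ 2 := dvd_pow hr' two_ne_zero
    rw [formX, orb, step_of_two_eq_zero h2] at h
    split_ifs at h
    · exact (hprime.dvd_or_dvd ((dvd_add_left (hsq.mul_left _)).1 h)).resolve_left he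
    · exact (dvd_add_left (hsq.mul_left _)).1 h
  exact (orb_coprime h2 0 (s := (1, 1)) (by simp) (by simp) hp
    (fun h _ => hp.not_isUnit (isUnit_of_dvd_one h)) j hq).2.2 hr'

/-- Modulo `2` the variable `a` enters this orbit only through the `a²` of its initial pair. -/
theorem pderiv_orbY (h2 : (2 : k) = 0) (j : ℕ) :
    pderiv 0 (orbY 𝐚 𝐝 𝐞 j).1 = 0 ∧ pderiv 0 (orbY 𝐚 𝐝 𝐞 j).2 = 0 := by
  have h1 : pderiv 0 𝐝 = 0 := pderiv_X_of_ne (by decide)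
  have h3 : pderiv 0 𝐞 = 0 := pderiv_X_of_ne (by decide)
  cases j with
  | zero => simp [orbY, orb, pderiv_sq h2, Derivation.leibniz, h1, h3]
  | succ j =>
    rw [orbY, orb, step_of_two_eq_zero h2]
    split_ifs <;> simp [pderiv_sq h2, Derivation.leibniz, h1, h3]

theorem pderiv_formY (h2 : (2 : k) = 0) (j : ℕ) :
    pderiv 0 (formY 𝐚 𝐝 𝐞 j) = (orbY 𝐚 𝐝 𝐞 j).1 := by
  have h1 : pderiv 0 𝐝 = 0 := pderiv_X_of_ne (by decide)
  have h3 : pderiv 0 𝐞 = 0 := pderiv_X_of_ne (by decide)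
  unfold formY
  split_ifs <;> simp [pderiv_orbY h2, Derivation.leibniz, h1, h3]

/-- The derivative in `a` is the coordinate `q`. A common factor of `q` and the form would divide `d
r` or `d e r`, contrary to `orb_coprime`. -/
theorem formY_squarefree (h2 : (2 : k) = 0) (j : ℕ) :
    formY 𝐚 𝐝 𝐞 j ≠ 0 ∧ Squarefree (formY 𝐚 𝐝 𝐞 j) := by
  have hneg : (-1 : k) = 1 := by linear_combination -h2
  have hs₁ : eval ![1, 0, 1] (𝐝 * 𝐞 - 𝐚 ^ 2, 𝐝).1 = 1 := by simp [hneg]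
  have hs₂ : eval ![1, 1, 0] (𝐝 * 𝐞 - 𝐚 ^ 2, 𝐝).1 = 1 ∧ eval ![1, 1, 0] (𝐝 * 𝐞 - 𝐚 ^ 2, 𝐝).2 = 1 := by
    simp [hneg]
  have h0 : formY 𝐚 𝐝 𝐞 j ≠ 0 := fun h => by
    have h' := (eval_orb h2 1 hs₁ hs₂ j).1
    rw [← orbY] at h'
    have : eval ![1, 0, 1] (formY 𝐚 𝐝 𝐞 j) = 1 := by
      unfold formY; split_ifs <;> simp [h']
    simp [h] at this
  refine ⟨h0, squarefree_of_pderiv h0 0 fun p hp h h' => ?_⟩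
  rw [pderiv_formY h2] at h'
  have hprime := hp.prime
  obtain ⟨hd, he, hr⟩ := orb_coprime h2 1 hs₁ hs₂ hp (fun h h' => not_dvd_of_dvd_X hp h'
    (v := ![1, 0, 1]) (by simp) (by rw [hs₁]; exact one_ne_zero) h) j h'
  unfold formY at h
  split_ifs at h
  · exact (hprime.dvd_or_dvd ((dvd_add_right (h'.mul_left _)).1 h)).elim
      (fun h => (hprime.dvd_or_dvd h).elim hd he) hr
  · exact (hprime.dvd_or_dvd ((dvd_add_right (h'.mul_left _)).1 h)).elim hd hr

end CharTwo

/-! ### Lifting square-freeness to characteristic zero -/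

section Lift

open MvPolynomial

variable {K : Type*} [Field K] (A : ValuationSubring K) {σ : Type*}

theorem mem_range_map_of_coeff {R S : Type*} [CommRing R] [CommRing S] {f : R →+* S}
    {p : MvPolynomial σ S} (h : ∀ n, p.coeff n ∈ Set.range f) :
    p ∈ Set.range (MvPolynomial.map (σ := σ) f) := by
  rw [mem_range_map_iff_coeffs_subset]
  intro x hx
  obtain ⟨n, -, rfl⟩ := mem_coeffs_iff.1 hx
  exact h n

/-- Divide by a coefficient of largest valuation: all coefficients become integral and one becomes
`1`. -/
theorem exists_primitive {G : MvPolynomial σ K} (hG : G ≠ 0) :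
    ∃ g : K, g ≠ 0 ∧ ∃ G₀ : MvPolynomial σ A, G = MvPolynomial.C g * MvPolynomial.map (algebraMap A K) G₀ ∧
      MvPolynomial.map (IsLocalRing.residue A) G₀ ≠ 0 := by
  obtain ⟨m, hm, hmax⟩ := G.support.exists_max_image (fun m => A.valuation (G.coeff m))
    (MvPolynomial.support_nonempty.2 hG)
  have hg0 : G.coeff m ≠ 0 := MvPolynomial.mem_support_iff.1 hm
  have hle (n : σ →₀ ℕ) : (G.coeff m)⁻¹ * G.coeff n ∈ A := by
    rw [← A.valuation_le_one_iff, map_mul, map_inv₀]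
    by_cases hn : n ∈ G.support
    · rw [mul_comm, ← div_eq_mul_inv]
      exact div_le_one_of_le₀ (hmax n hn) zero_le
    · rw [MvPolynomial.notMem_support_iff.1 hn, map_zero, mul_zero]
      exact zero_le
  have hrange {x : K} (hx : x ∈ A) : x ∈ Set.range (algebraMap A K) := ⟨⟨x, hx⟩, rfl⟩
  obtain ⟨G₀, hG₀⟩ : MvPolynomial.C (G.coeff m)⁻¹ * G ∈
      Set.range (MvPolynomial.map (σ := σ) (algebraMap A K)) := by
    refine mem_range_map_of_coeff fun n => ?_
    rw [MvPolynomial.coeff_C_mul]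
    exact hrange (hle n)
  refine ⟨G.coeff m, hg0, G₀, ?_, fun h => ?_⟩
  · rw [hG₀, ← mul_assoc, ← MvPolynomial.C_mul, mul_inv_cancel₀ hg0, MvPolynomial.C_1, one_mul]
  · have h1 : algebraMap A K (G₀.coeff m) = 1 := by
      rw [← MvPolynomial.coeff_map, hG₀, MvPolynomial.coeff_C_mul, inv_mul_cancel₀ hg0]
    have h1' : G₀.coeff m = 1 := IsFractionRing.injective A K (h1.trans (map_one _).symm)
    have := congrArg (MvPolynomial.coeff m) h
    rw [MvPolynomial.coeff_map, h1', map_one, MvPolynomial.coeff_zero] at this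
    exact one_ne_zero this

/-- One of `u`, `u⁻¹` lies in `A`. Reducing the corresponding relation, its residue cannot be zero
because both reductions are nonzero. -/
theorem exists_smul_eq_of_map_eq {F H : MvPolynomial σ A} {u : K} (hu : u ≠ 0)
    (h : MvPolynomial.map (algebraMap A K) F = MvPolynomial.C u * MvPolynomial.map (algebraMap A K) H)
    (hF : MvPolynomial.map (IsLocalRing.residue A) F ≠ 0) (hH : MvPolynomial.map (IsLocalRing.residue A) H ≠ 0) :
    Associated (MvPolynomial.map (IsLocalRing.residue A) F) (MvPolynomial.map (IsLocalRing.residue A) H) := by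
  have hinj : Function.Injective (MvPolynomial.map (σ := σ) (algebraMap A K)) :=
    MvPolynomial.map_injective _ (IsFractionRing.injective A K)
  rcases A.mem_or_inv_mem u with hm | hm
  · have h' : F = MvPolynomial.C (⟨u, hm⟩ : A) * H := hinj (by rw [h, map_mul, MvPolynomial.map_C]; rfl)
    have h₁ := congrArg (MvPolynomial.map (IsLocalRing.residue A)) h'
    rw [map_mul, MvPolynomial.map_C] at h₁
    rw [h₁] at hF ⊢
    have hu' : IsLocalRing.residue A ⟨u, hm⟩ ≠ 0 := fun h => hF (by rw [h]; simp)
    exact associated_unit_mul_left _ _ ((isUnit_iff_ne_zero.2 hu').map MvPolynomial.C)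
  · have h' : H = MvPolynomial.C (⟨u⁻¹, hm⟩ : A) * F := hinj (by
      rw [map_mul, MvPolynomial.map_C, h, ← mul_assoc]
      change _ = MvPolynomial.C u⁻¹ * _ * _
      rw [← MvPolynomial.C_mul, inv_mul_cancel₀ hu, MvPolynomial.C_1, one_mul])
    have h₁ := congrArg (MvPolynomial.map (IsLocalRing.residue A)) h'
    rw [map_mul, MvPolynomial.map_C] at h₁
    rw [h₁] at hH ⊢
    have hu' : IsLocalRing.residue A ⟨u⁻¹, hm⟩ ≠ 0 := fun h => hH (by rw [h]; simp)
    exact (associated_unit_mul_left _ _ ((isUnit_iff_ne_zero.2 hu').map MvPolynomial.C)).symm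

/-- If `F = G²H`, make `G` and `H` primitive. The reduction of `G` squares into that of `F`, so it
is a unit, and the reduction of `F` has degree at most `deg H`. As reduction does not lower the
degree of `F`, this forces `deg G = 0`. -/
theorem squarefree_of_residue (F : MvPolynomial σ A) (h0 : MvPolynomial.map (IsLocalRing.residue A) F ≠ 0)
    (hF : Squarefree (MvPolynomial.map (IsLocalRing.residue A) F))
    (hdeg : (MvPolynomial.map (algebraMap A K) F).totalDegree ≤ (MvPolynomial.map (IsLocalRing.residue A) F).totalDegree) :
    Squarefree (MvPolynomial.map (algebraMap A K) F) := by
  rintro G ⟨H, hGH⟩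
  have hFK : MvPolynomial.map (algebraMap A K) F ≠ 0 := by
    intro h
    have : F = 0 := MvPolynomial.map_injective _ (IsFractionRing.injective A K) (by simpa using h)
    simp [this] at h0
  have hG : G ≠ 0 := by rintro rfl; simp at hGH; exact hFK hGH
  have hH : H ≠ 0 := by rintro rfl; simp at hGH; exact hFK hGH
  obtain ⟨g, hg, G₀, rfl, hG₀⟩ := exists_primitive A hG
  obtain ⟨h, hh, H₀, rfl, hH₀⟩ := exists_primitive A hH
  have hass := exists_smul_eq_of_map_eq A (F := F) (H := G₀ * G₀ * H₀) (u := g * g * h)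
    (by simp [hg, hh]) (by rw [hGH]; simp only [map_mul]; ring) h0 (by simp [hG₀, hH₀])
  simp only [map_mul] at hass
  have hunit : IsUnit (MvPolynomial.map (IsLocalRing.residue A) G₀) :=
    hF _ ((dvd_mul_right _ _).trans hass.symm.dvd)
  have hinj : Function.Injective (algebraMap A K) := IsFractionRing.injective A K
  have h₁ := totalDegree_le_of_dvd_of_isDomain hass.dvd (by simp [hG₀, hH₀])
  have hres : (MvPolynomial.map (IsLocalRing.residue A) H₀).totalDegree ≤
      (MvPolynomial.map (algebraMap A K) H₀).totalDegree := by
    refine Finset.sup_mono ?_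
    rw [MvPolynomial.support_map_of_injective _ hinj]
    exact MvPolynomial.support_map_subset _ _
  have hG₀' : (MvPolynomial.map (IsLocalRing.residue A) G₀).totalDegree = 0 :=
    (isUnit_iff_totalDegree_of_isReduced.1 hunit).2
  rw [totalDegree_mul_of_isDomain (mul_ne_zero hG₀ hG₀) hH₀, totalDegree_mul_of_isDomain hG₀ hG₀,
    hG₀', zero_add, zero_add] at h₁
  rw [hGH, totalDegree_mul_of_isDomain (mul_ne_zero hG hG) hH, totalDegree_mul_of_isDomain hG hG]
    at hdeg
  have hH' := totalDegree_le_of_dvd_of_isDomain (Dvd.intro_left (MvPolynomial.C h) rfl) hH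
  have hG' : (MvPolynomial.C g * MvPolynomial.map (algebraMap A K) G₀).totalDegree = 0 := by omega
  rw [totalDegree_eq_zero_iff_eq_C] at hG'
  rw [hG'] at hG ⊢
  refine (isUnit_iff_ne_zero.2 fun h => hG ?_).map MvPolynomial.C
  rw [h, map_zero]

/-- A form with integral coefficients in the sense of the valuation ring, whose reduction is
square-free, is square-free. -/
theorem squarefree_of_residue_of_isHomogeneous (F : MvPolynomial σ A) {n : ℕ}
    (hn : F.IsHomogeneous n) (h0 : MvPolynomial.map (IsLocalRing.residue A) F ≠ 0)
    (hF : Squarefree (MvPolynomial.map (IsLocalRing.residue A) F)) :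
    Squarefree (MvPolynomial.map (algebraMap A K) F) := by
  refine squarefree_of_residue A F h0 hF ?_
  rw [(hn.map (IsLocalRing.residue A)).totalDegree h0]
  exact (hn.map (algebraMap A K)).totalDegree_le

/-- A field of characteristic zero carries a valuation ring of residue characteristic two. -/
theorem exists_valuationSubring_residue_two (K : Type*) [Field K] [CharZero K] :
    ∃ A : ValuationSubring K, (2 : IsLocalRing.ResidueField A) = 0 := by
  -- `2` generates a proper ideal of the image of `ℤ`, so some valuation ring containing this image
  -- has `2` as a nonunit.
  let Z : Subring K := (Int.castRingHom K).range
  have hI : Ideal.span {(2 : Z)} ≠ ⊤ := by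
    intro h
    obtain ⟨⟨_, m, rfl⟩, hx⟩ := Ideal.mem_span_singleton'.1 ((Ideal.eq_top_iff_one _).1 h)
    have : (m : K) * 2 = 1 := congrArg Subtype.val hx
    have : m * 2 = 1 := by exact_mod_cast this
    omega
  obtain ⟨A, -, hA⟩ := Ideal.image_subset_nonunits_valuationSubring _ hI
  refine ⟨A, ?_⟩
  have h2 : (2 : K) ∈ A.nonunits := hA ⟨2, Ideal.mem_span_singleton_self _, rfl⟩
  have : (2 : A) ∈ IsLocalRing.maximalIdeal A := by
    rw [ValuationSubring.mem_nonunits_iff_exists_mem_maximalIdeal] at h2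
    obtain ⟨h, h'⟩ := h2
    exact h'
  rw [← map_ofNat (IsLocalRing.residue A) 2]
  exact (IsLocalRing.residue_eq_zero_iff _).2 this

theorem formX_squarefree_of_charZero (K : Type*) [Field K] [CharZero K] (j : ℕ) :
    Squarefree (formX (MvPolynomial.X 0) (MvPolynomial.X 1) (MvPolynomial.X 2) (j + 1) :
      MvPolynomial (Fin 3) K) := by
  obtain ⟨A, hA⟩ := exists_valuationSubring_residue_two K
  have h := squarefree_of_residue_of_isHomogeneous A _ (formX_isHomogeneous
    (isHomogeneous_X A (0 : Fin 3)) (isHomogeneous_X A 1) (isHomogeneous_X A 2) (j + 1))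
  simp only [map_formX, MvPolynomial.map_X] at h
  exact h (formX_ne_zero_of_two_eq_zero hA _) (formX_squarefree hA j)

theorem formY_squarefree_of_charZero (K : Type*) [Field K] [CharZero K] (j : ℕ) :
    Squarefree (formY (MvPolynomial.X 0) (MvPolynomial.X 1) (MvPolynomial.X 2) j :
      MvPolynomial (Fin 3) K) := by
  obtain ⟨A, hA⟩ := exists_valuationSubring_residue_two K
  have h := squarefree_of_residue_of_isHomogeneous A _ (formY_isHomogeneous
    (isHomogeneous_X A (0 : Fin 3)) (isHomogeneous_X A 1) (isHomogeneous_X A 2) j)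
  simp only [map_formY, MvPolynomial.map_X] at h
  exact h (formY_squarefree hA j).1 (formY_squarefree hA j).2

end Lift

/-! ### Zero sets of forms in the projective plane -/

section Forms

variable {F : MvPolynomial (Fin 3) ℂ} {k : ℕ}

theorem IsHomogeneous.sum_exponents (hF : F.IsHomogeneous k) {m : Fin 3 →₀ ℕ} (hm : m ∈ F.support) :
    m 0 + m 1 + m 2 = k := by
  have := hF (MvPolynomial.mem_support_iff.1 hm)
  rw [← this, Finsupp.weight_apply, Finsupp.sum_fintype _ _ (by simp)]
  simp [Fin.sum_univ_three]

theorem IsHomogeneous.eval_smul (hF : F.IsHomogeneous k) (c : ℂ) (v : Fin 3 → ℂ) :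
    MvPolynomial.eval (c • v) F = c ^ k * MvPolynomial.eval v F := by
  rw [MvPolynomial.eval_eq', MvPolynomial.eval_eq', Finset.mul_sum]
  refine Finset.sum_congr rfl fun m hm => ?_
  simp only [Fin.prod_univ_three, Pi.smul_apply, smul_eq_mul, mul_pow,
    ← IsHomogeneous.sum_exponents hF hm]
  ring

theorem IsHomogeneous.eval_smul_eq_zero (hF : F.IsHomogeneous k) {c : ℂ} (hc : c ≠ 0)
    (v : Fin 3 → ℂ) : MvPolynomial.eval (c • v) F = 0 ↔ MvPolynomial.eval v F = 0 := by
  rw [IsHomogeneous.eval_smul hF, mul_eq_zero, or_iff_right (pow_ne_zero _ hc)]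

/-- The restriction `F (y + s w)` of `F` to a line, as a polynomial in `s`. -/
def linePoly (F : MvPolynomial (Fin 3) ℂ) (y w : Fin 3 → ℂ) : ℂ[X] :=
  MvPolynomial.aeval (fun i => C (w i) * Polynomial.X + C (y i)) F

theorem eval_linePoly (y w : Fin 3 → ℂ) (s : ℂ) :
    (linePoly F y w).eval s = MvPolynomial.eval (y + s • w) F := by
  rw [linePoly, ← Polynomial.coe_evalRingHom, MvPolynomial.aeval_def, MvPolynomial.eval₂_comp_left,
    MvPolynomial.eval, MvPolynomial.coe_eval₂Hom]
  congr 1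
  · ext z; simp
  · ext i; simp; ring

/-- The top coefficient in `s` of `F (y + s w)` does not depend on `y`; the roots in `s` can thus be
controlled uniformly as `y` moves. -/
theorem coeff_linePoly (hF : F.IsHomogeneous k) (y w : Fin 3 → ℂ) :
    (linePoly F y w).coeff k = MvPolynomial.eval w F := by
  rw [linePoly, MvPolynomial.aeval_def, MvPolynomial.eval₂_eq', MvPolynomial.eval_eq',
    Polynomial.finsetSum_coeff]
  refine Finset.sum_congr rfl fun m hm => ?_
  have hdeg (i : Fin 3) : (C (w i) * Polynomial.X + C (y i)).natDegree ≤ 1 := natDegree_linear_le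
  have hpow (i : Fin 3) : ((C (w i) * Polynomial.X + C (y i)) ^ m i).natDegree ≤ m i := by
    simpa using natDegree_pow_le_of_le (m i) (hdeg i)
  have hcoeff (i : Fin 3) : ((C (w i) * Polynomial.X + C (y i)) ^ m i).coeff (m i) = w i ^ m i := by
    have := coeff_pow_of_natDegree_le (m := m i) (hdeg i)
    simpa using this
  rw [Polynomial.algebraMap_eq, Polynomial.coeff_C_mul, Fin.prod_univ_three, Fin.prod_univ_three,
    ← IsHomogeneous.sum_exponents hF hm,
    coeff_mul_add_eq_of_natDegree_le (natDegree_mul_le_of_le (hpow 0) (hpow 1)) (hpow 2),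
    coeff_mul_add_eq_of_natDegree_le (hpow 0) (hpow 1), hcoeff, hcoeff, hcoeff]

theorem natDegree_linePoly_le (hF : F.IsHomogeneous k) (y w : Fin 3 → ℂ) :
    (linePoly F y w).natDegree ≤ k := by
  have := MvPolynomial.aeval_natDegree_le (m := k) (n := 1) F hF.totalDegree_le
    (fun i => C (w i) * Polynomial.X + C (y i)) (fun i => natDegree_linear_le)
  simpa [linePoly] using this

theorem pow_card_le_norm_prod {δ : ℝ} (hδ : 0 ≤ δ) (m : Multiset ℂ) (h : ∀ s ∈ m, δ ≤ ‖s‖) :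
    δ ^ m.card ≤ ‖m.prod‖ := by
  induction m using Multiset.induction_on with
  | empty => simp
  | cons a m ih =>
    rw [Multiset.card_cons, Multiset.prod_cons, norm_mul, pow_succ']
    exact mul_le_mul (h a (by simp)) (ih fun s hs => h s (by simp [hs])) (by positivity)
      (norm_nonneg _)

/-- A complex polynomial whose constant coefficient is small compared to its leading coefficient
has a small root. -/
theorem exists_root_norm_lt {f : ℂ[X]} {δ : ℝ} (hδ : 0 ≤ δ)
    (h : ‖f.eval 0‖ < ‖f.leadingCoeff‖ * δ ^ f.natDegree) : ∃ s, f.eval s = 0 ∧ ‖s‖ < δ := by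
  by_contra! hcon
  have hf : f ≠ 0 := by rintro rfl; simp at h
  have hsp := IsAlgClosed.splits f
  have h₁ := pow_card_le_norm_prod hδ f.roots fun s hs => hcon s ((mem_roots hf).1 hs)
  rw [← coeff_zero_eq_eval_zero, hsp.coeff_zero_eq_leadingCoeff_mul_prod_roots,
    hsp.natDegree_eq_card_roots] at h
  simp only [norm_mul, norm_pow, norm_neg, norm_one, one_pow, one_mul] at h
  exact absurd h (not_lt.2 (mul_le_mul_of_nonneg_left h₁ (norm_nonneg _)))

theorem exists_root_linePoly (hF : F.IsHomogeneous k) {y w : Fin 3 → ℂ} {δ : ℝ} (hδ : 0 ≤ δ)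
    (h : ‖MvPolynomial.eval y F‖ < ‖MvPolynomial.eval w F‖ * δ ^ k) :
    ∃ s : ℂ, MvPolynomial.eval (y + s • w) F = 0 ∧ ‖s‖ < δ := by
  have hw : MvPolynomial.eval w F ≠ 0 := by
    intro h0
    rw [h0, norm_zero, zero_mul] at h
    exact absurd h (not_lt.2 (norm_nonneg _))
  have hdeg : (linePoly F y w).natDegree = k :=
    le_antisymm (natDegree_linePoly_le hF y w)
      (le_natDegree_of_ne_zero (by rwa [coeff_linePoly hF]))
  obtain ⟨s, hs, hs'⟩ := exists_root_norm_lt (f := linePoly F y w) hδ (by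
    rw [leadingCoeff, hdeg, coeff_linePoly hF, eval_linePoly]
    simpa using h)
  exact ⟨s, by rwa [eval_linePoly] at hs, hs'⟩

theorem eventually_eval_line_ne_zero {y w : Fin 3 → ℂ} {t₀ : ℂ}
    (h : MvPolynomial.eval (y + t₀ • w) F ≠ 0) :
    ∀ᶠ t in nhdsWithin (0 : ℂ) {0}ᶜ, MvPolynomial.eval (y + t • w) F ≠ 0 := by
  have hf : linePoly F y w ≠ 0 := by
    intro h0
    rw [← eval_linePoly, h0, eval_zero] at h
    exact h rfl
  have hfin : {t : ℂ | (linePoly F y w).eval t = 0}.Finite := by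
    refine (linePoly F y w).roots.toFinset.finite_toSet.subset fun t ht => ?_
    simpa [hf] using ht
  have hmem := (hfin.subset (Set.sdiff_subset (t := {0}))).isClosed.isOpen_compl.mem_nhds
    (show (0 : ℂ) ∈ _ by simp)
  filter_upwards [nhdsWithin_le_nhds hmem, self_mem_nhdsWithin] with t ht ht'
  intro h0
  exact ht ⟨by rw [Set.mem_ofPred_eq, eval_linePoly]; exact h0, ht'⟩

/-- If a form does not vanish at `[1 : 0 : 0]`, then its zeros off the coordinate lines through
this point are dense in the set of its zeros. -/
theorem mem_closure_zeros (hF : F.IsHomogeneous k) (hb : MvPolynomial.eval ![1, 0, 0] F ≠ 0)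
    {v : Fin 3 → ℂ} (hv : MvPolynomial.eval v F = 0) :
    v ∈ closure {z : Fin 3 → ℂ | MvPolynomial.eval z F = 0 ∧ z 1 ≠ 0 ∧ z 2 ≠ 0} := by
  set b : Fin 3 → ℂ := ![1, 0, 0] with hbdef
  have hF0 : F ≠ 0 := by rintro rfl; simp at hb
  -- A direction `w` with `F w ≠ 0` and both coordinates `w 1`, `w 2` nonzero. The point `v` is
  -- pushed slightly towards `b`, then corrected along `w` to a zero of `F`.
  obtain ⟨w, hw⟩ : ∃ w : Fin 3 → ℂ,
      MvPolynomial.eval w (F * MvPolynomial.X 1 * MvPolynomial.X 2) ≠ 0 := by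
    by_contra! hcon
    have h0 : F * MvPolynomial.X 1 * MvPolynomial.X 2 = 0 :=
      MvPolynomial.funext fun x => by rw [hcon, map_zero]
    simp [hF0] at h0
  simp only [map_mul, MvPolynomial.eval_X, mul_ne_zero_iff] at hw
  obtain ⟨⟨hw₀, hw₁⟩, hw₂⟩ := hw
  have hgen (i : Fin 3) (hi : w i ≠ 0) (hbi : b i = 0) : ∀ᶠ t in nhdsWithin (0 : ℂ) {0}ᶜ,
      ∀ s : ℂ, MvPolynomial.eval (v + t • (b - v) + s • w) F = 0 →
        (v + t • (b - v) + s • w) i ≠ 0 := by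
    -- This line is the projection along `w` to the plane where coordinate `i` vanishes of the line
    -- from `v` to `b`. It reaches `b` at `t = 1`, where `F` does not vanish, so only finitely many
    -- `t` are bad.
    have := eventually_eval_line_ne_zero (F := F) (t₀ := 1) (y := v - (v i / w i) • w)
      (w := b - v + (v i / w i) • w) (by convert hb using 2; simp)
    filter_upwards [this] with t ht s hs hz
    apply ht
    rw [← hs]
    refine congrArg (fun z => MvPolynomial.eval z F) ?_
    have hs' : s = -(v i + t * (b i - v i)) / w i := by
      simp only [Pi.add_apply, Pi.smul_apply, Pi.sub_apply, smul_eq_mul] at hz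
      field_simp
      linear_combination hz
    rw [hs', hbi]
    ext j
    simp only [Pi.add_apply, Pi.smul_apply, Pi.sub_apply, smul_eq_mul]
    ring
  rw [Metric.mem_closure_iff]
  intro ε hε
  set δ : ℝ := ε / 2 / (‖w‖ + 1) with hδdef
  have hδ : 0 < δ := by positivity
  have hcont : Filter.Tendsto (fun t : ℂ => v + t • (b - v)) (nhdsWithin (0 : ℂ) {0}ᶜ) (nhds v) := by
    have : Continuous fun t : ℂ => v + t • (b - v) := by fun_prop
    simpa using (this.tendsto 0).mono_left nhdsWithin_le_nhds
  have hsmall := ((MvPolynomial.continuous_eval F).tendsto v).comp hcont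
  rw [hv] at hsmall
  have hpos : 0 < ‖MvPolynomial.eval w F‖ * δ ^ k :=
    mul_pos (norm_pos_iff.2 hw₀) (pow_pos hδ k)
  obtain ⟨t, h₁, h₂, h₃, h₄⟩ := ((hgen 1 hw₁ (by simp [hbdef])).and
    ((hgen 2 hw₂ (by simp [hbdef])).and ((hcont.eventually (Metric.ball_mem_nhds v (half_pos hε))).and
      (hsmall.eventually (Metric.ball_mem_nhds 0 hpos))))).exists
  obtain ⟨s, hs, hsδ⟩ := exists_root_linePoly hF (y := v + t • (b - v)) (w := w) hδ.le
    (by simpa using h₄)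
  refine ⟨_, ⟨hs, h₁ s hs, h₂ s hs⟩, ?_⟩
  rw [dist_comm, dist_eq_norm, add_sub_right_comm]
  rw [dist_eq_norm] at h₃
  refine (norm_add_le _ _).trans_lt ?_
  have : ‖s • w‖ ≤ ε / 2 := by
    rw [norm_smul]
    calc ‖s‖ * ‖w‖ ≤ δ * (‖w‖ + 1) := by gcongr; linarith
      _ = ε / 2 := by rw [hδdef]; field_simp
  linarith

theorem mk_mem_iff_of_isHomogeneous (hF : F.IsHomogeneous k) (v : Fin 3 → ℂ) (hv : v ≠ 0) :
    MvPolynomial.eval (Projectivization.mk ℂ v hv).rep F = 0 ↔ MvPolynomial.eval v F = 0 := by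
  obtain ⟨a, ha⟩ := Projectivization.exists_smul_eq_mk_rep ℂ v hv
  rw [← ha]
  exact IsHomogeneous.eval_smul_eq_zero hF a.ne_zero v

theorem continuous_mk :
    Continuous (fun v : {v : Fin 3 → ℂ // v ≠ 0} => (Projectivization.mk ℂ v.1 v.2 : CP2)) :=
  continuous_coinduced_rng

theorem mk_eq_affinePoint {z : Fin 3 → ℂ} (hz : z ≠ 0) (h : z 2 ≠ 0) :
    (Projectivization.mk ℂ z hz : CP2) = affinePoint (z 0 / z 2) (z 1 / z 2) := by
  rw [affinePoint, Projectivization.mk_eq_mk_iff']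
  refine ⟨z 2, ?_⟩
  ext i
  fin_cases i <;> simp <;> field_simp

/-! ### Closures of parameter loci as plane curves -/

variable {S : Set Moduli}

/-- The zero set of a form is closed in the quotient topology. Conversely, zeros with `d` and `e`
nonzero rescale to `e = 1` and lie in the locus, and their density passes through the continuous
projection. -/
theorem mk_mem_closure_trace_iff (hF : F.IsHomogeneous k)
    (hb : MvPolynomial.eval ![1, 0, 0] F ≠ 0)
    (hS : ∀ (c d : ℂ) (hd : d ≠ 0), (family c d hd).cls ∈ S ↔ MvPolynomial.eval ![c, d, 1] F = 0)
    (v : Fin 3 → ℂ) (hv : v ≠ 0) :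
    (Projectivization.mk ℂ v hv : CP2) ∈ closure (trace S) ↔ MvPolynomial.eval v F = 0 := by
  constructor
  · have hclosed : IsClosed {x : CP2 | MvPolynomial.eval x.rep F = 0} := by
      rw [isClosed_coinduced]
      convert (isClosed_singleton (x := (0 : ℂ))).preimage
        ((MvPolynomial.continuous_eval F).comp continuous_subtype_val) using 1
      ext v
      exact mk_mem_iff_of_isHomogeneous hF v.1 v.2
    intro h
    rw [← mk_mem_iff_of_isHomogeneous hF v hv]
    refine hclosed.closure_subset_iff.2 ?_ h
    rintro _ ⟨c, d, hd, hcd, rfl⟩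
    exact (mk_mem_iff_of_isHomogeneous hF _ _).2 ((hS c d hd).1 hcd)
  · intro h
    have h₁ := mem_closure_zeros hF hb h
    have h₂ : (⟨v, hv⟩ : {v : Fin 3 → ℂ // v ≠ 0}) ∈
        closure {z | MvPolynomial.eval z.1 F = 0 ∧ z.1 1 ≠ 0 ∧ z.1 2 ≠ 0} := by
      rw [closure_subtype]
      convert h₁ using 2
      ext z
      constructor
      · rintro ⟨z, hz, rfl⟩
        exact hz
      · exact fun hz => ⟨⟨z, fun h => hz.2.1 (by simp [h])⟩, hz, rfl⟩
    refine closure_mono ?_ (image_closure_subset_closure_image continuous_mk ⟨_, h₂, rfl⟩)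
    rintro _ ⟨⟨z, hz⟩, ⟨hz₀, hz₁, hz₂⟩, rfl⟩
    refine ⟨z 0 / z 2, z 1 / z 2, div_ne_zero hz₁ hz₂, ?_, mk_eq_affinePoint hz hz₂⟩
    rw [hS, ← IsHomogeneous.eval_smul_eq_zero hF hz₂, ← hz₀]
    congr! 2
    ext i
    fin_cases i <;> simp <;> field_simp

theorem isCurveOfDegree_closure_trace (hF : F.IsHomogeneous k) (hsq : Squarefree F)
    (hb : MvPolynomial.eval ![1, 0, 0] F ≠ 0)
    (hS : ∀ (c d : ℂ) (hd : d ≠ 0), (family c d hd).cls ∈ S ↔ MvPolynomial.eval ![c, d, 1] F = 0) :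
    IsCurveOfDegree (closure (trace S)) k := by
  have hmem := mk_mem_closure_trace_iff hF hb hS
  have hF0 : F ≠ 0 := by rintro rfl; simp at hb
  refine ⟨F, hF0, hF, hmem, le_antisymm (fun G hG => ?_) ?_⟩
  · rw [Ideal.mem_span_singleton]
    -- The cone omits the origin, where `G` is not known to vanish; the factor `X 1` takes care of
    -- that point. It can be cancelled afterwards because it does not divide `F`, which is nonzero
    -- at `[1 : 0 : 0]`.
    have hdvd : F ∣ MvPolynomial.X 1 * G := by
      have hrad : MvPolynomial.X 1 * G ∈ (Ideal.span {F}).radical := by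
        rw [← MvPolynomial.vanishingIdeal_zeroLocus_eq_radical (K := ℂ)]
        intro x hx
        have hFx : MvPolynomial.eval x F = 0 := by
          simpa using hx F (Ideal.mem_span_singleton_self F)
        by_cases hx0 : x = 0
        · simp [hx0]
        · have := hG x ⟨hx0, (hmem x hx0).2 hFx⟩
          rw [map_mul, this, mul_zero]
      obtain ⟨n, hn⟩ := hrad
      exact hsq.isRadical n _ (Ideal.mem_span_singleton.1 hn)
    obtain ⟨H, hH⟩ := hdvd
    rcases MvPolynomial.X_prime.dvd_or_dvd (Dvd.intro _ hH) with ⟨F', rfl⟩ | ⟨H', rfl⟩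
    · simp at hb
    · refine ⟨H', mul_left_cancel₀ (MvPolynomial.X_ne_zero (1 : Fin 3)) ?_⟩
      rw [hH]; ring
  · rw [Ideal.span_singleton_le_iff_mem]
    rintro v ⟨hv, hvZ⟩
    simpa using (hmem v hv).1 hvZ

/-! ### Return from `a` to `c = 2a` -/

theorem squarefree_aeval_scale (hF : Squarefree F) :
    Squarefree (MvPolynomial.aeval (![MvPolynomial.C 2⁻¹ * MvPolynomial.X 0, MvPolynomial.X 1,
      MvPolynomial.X 2] : Fin 3 → MvPolynomial (Fin 3) ℂ) F) := by
  set ψ : MvPolynomial (Fin 3) ℂ →ₐ[ℂ] MvPolynomial (Fin 3) ℂ := MvPolynomial.aeval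
    ![MvPolynomial.C 2⁻¹ * MvPolynomial.X 0, MvPolynomial.X 1, MvPolynomial.X 2] with hψ
  -- The inverse substitution; an automorphism preserves square-freeness.
  set φ : MvPolynomial (Fin 3) ℂ →ₐ[ℂ] MvPolynomial (Fin 3) ℂ := MvPolynomial.aeval
    ![MvPolynomial.C 2 * MvPolynomial.X 0, MvPolynomial.X 1, MvPolynomial.X 2] with hφ
  have hc : (MvPolynomial.C 2⁻¹ * MvPolynomial.C 2 : MvPolynomial (Fin 3) ℂ) = 1 := by
    rw [← MvPolynomial.C_mul, inv_mul_cancel₀ two_ne_zero, MvPolynomial.C_1]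
  have hc' : (MvPolynomial.C 2 * MvPolynomial.C 2⁻¹ : MvPolynomial (Fin 3) ℂ) = 1 := by
    rw [mul_comm, hc]
  have hφψ : φ.comp ψ = AlgHom.id ℂ _ := by
    ext i : 1
    fin_cases i <;> simp [hφ, hψ, MvPolynomial.algHom_C, ← mul_assoc, hc]
  have hψφ : ψ.comp φ = AlgHom.id ℂ _ := by
    ext i : 1
    fin_cases i <;> simp [hφ, hψ, MvPolynomial.algHom_C, ← mul_assoc, hc']
  intro G hG
  have h₁ : φ G * φ G ∣ F := by
    have := map_dvd φ hG
    rwa [map_mul, ← AlgHom.comp_apply, hφψ] at this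
  have h₂ := (hF _ h₁).map ψ
  rwa [← AlgHom.comp_apply, hψφ] at h₂

theorem isHomogeneous_C_mul_X (c : ℂ) (i : Fin 3) :
    (MvPolynomial.C c * MvPolynomial.X i : MvPolynomial (Fin 3) ℂ).IsHomogeneous 1 := by
  simpa using (MvPolynomial.isHomogeneous_C (Fin 3) c).mul (MvPolynomial.isHomogeneous_X ℂ i)

/-- The form in `(c, d, e)` defining the closure of the locus of `X (j + 2)`. -/
def polyX (j : ℕ) : MvPolynomial (Fin 3) ℂ :=
  formX (MvPolynomial.C 2⁻¹ * MvPolynomial.X 0) (MvPolynomial.X 1) (MvPolynomial.X 2) j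

/-- The form in `(c, d, e)` defining the closure of the locus of `Y (j + 1)`. -/
def polyY (j : ℕ) : MvPolynomial (Fin 3) ℂ :=
  formY (MvPolynomial.C 2⁻¹ * MvPolynomial.X 0) (MvPolynomial.X 1) (MvPolynomial.X 2) j

theorem eval_polyX (v : Fin 3 → ℂ) (j : ℕ) :
    MvPolynomial.eval v (polyX j) = formX (2⁻¹ * v 0) (v 1) (v 2) j := by
  rw [polyX, map_formX]; simp

theorem eval_polyY (v : Fin 3 → ℂ) (j : ℕ) :
    MvPolynomial.eval v (polyY j) = formY (2⁻¹ * v 0) (v 1) (v 2) j := by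
  rw [polyY, map_formY]; simp

theorem polyX_isHomogeneous (j : ℕ) : (polyX j).IsHomogeneous (orbDeg 0 0 j) :=
  formX_isHomogeneous (isHomogeneous_C_mul_X _ _) (MvPolynomial.isHomogeneous_X _ _)
    (MvPolynomial.isHomogeneous_X _ _) j

theorem polyY_isHomogeneous (j : ℕ) : (polyY j).IsHomogeneous (orbDeg 1 2 j + 1) :=
  formY_isHomogeneous (isHomogeneous_C_mul_X _ _) (MvPolynomial.isHomogeneous_X _ _)
    (MvPolynomial.isHomogeneous_X _ _) j

theorem polyX_squarefree (j : ℕ) : Squarefree (polyX (j + 1)) := by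
  have := squarefree_aeval_scale (formX_squarefree_of_charZero ℂ j)
  rw [← AlgHom.coe_toRingHom, map_formX] at this
  simpa [polyX] using this

theorem polyY_squarefree (j : ℕ) : Squarefree (polyY j) := by
  have := squarefree_aeval_scale (formY_squarefree_of_charZero ℂ j)
  rw [← AlgHom.coe_toRingHom, map_formY] at this
  simpa [polyY] using this

theorem eval_polyX_ne_zero (j : ℕ) : MvPolynomial.eval ![1, 0, 0] (polyX (j + 1)) ≠ 0 := by
  have h := map_formX Complex.ofRealHom (2⁻¹ : ℝ) 0 0 (j + 1)
  have h' := (formX_pos (a := 2⁻¹) (by norm_num) j).ne'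
  rw [eval_polyX]
  simp only [map_zero, map_inv₀, map_ofNat, Complex.ofRealHom_eq_coe] at h
  simpa [← h] using h'

theorem eval_polyY_ne_zero (j : ℕ) : MvPolynomial.eval ![1, 0, 0] (polyY j) ≠ 0 := by
  have h := map_formY Complex.ofRealHom (2⁻¹ : ℝ) 0 0 j
  have h' := formY_ne_zero (a := 2⁻¹) (by norm_num) j
  rw [eval_polyY]
  simp only [map_zero, map_inv₀, map_ofNat, Complex.ofRealHom_eq_coe] at h
  simpa [← h] using h'

theorem family_mem_X_iff (j : ℕ) (c d : ℂ) (hd : d ≠ 0) :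
    (family c d hd).cls ∈ X (j + 2) ↔ MvPolynomial.eval ![c, d, 1] (polyX j) = 0 := by
  obtain ⟨a, rfl⟩ : ∃ a, c = 2 * a := ⟨2⁻¹ * c, by ring⟩
  rw [family_mem_X, eval_polyX]
  simp

theorem family_mem_Y_iff (j : ℕ) (c d : ℂ) (hd : d ≠ 0) :
    (family c d hd).cls ∈ Y (j + 1) ↔ MvPolynomial.eval ![c, d, 1] (polyY j) = 0 := by
  obtain ⟨a, rfl⟩ : ∃ a, c = 2 * a := ⟨2⁻¹ * c, by ring⟩
  rw [family_mem_Y, eval_polyY]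
  simp

end Forms

end QuadRat

end

theorem mainTheorem5 :
    (∀ n : ℕ, 3 ≤ n → ∃ k : ℕ,
      QuadRat.IsCurveOfDegree (closure (QuadRat.trace (QuadRat.X n))) k ∧
        (k : ℚ) = 1 / 6 * 2 ^ n - 1 / 2 - 1 / 6 * (-1) ^ n) ∧
    (∀ m : ℕ, 1 ≤ m → ∃ k : ℕ,
      QuadRat.IsCurveOfDegree (closure (QuadRat.trace (QuadRat.Y m))) k ∧
        (k : ℚ) = 7 / 6 * 2 ^ m + 1 / 2 - 1 / 6 * (-1) ^ m) ∧
    (∀ n : ℕ, 3 ≤ n →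
      Projectivization.mk ℂ ![1, 0, 0] (by simp) ∉ closure (QuadRat.trace (QuadRat.X n)) ∧
      Projectivization.mk ℂ ![0, 1, 0] (by simp) ∉ closure (QuadRat.trace (QuadRat.X n)) ∧
      Projectivization.mk ℂ ![0, 0, 1] (by simp) ∉ closure (QuadRat.trace (QuadRat.X n))) := by
  refine ⟨fun n hn => ?_, fun m hm => ?_, fun n hn => ?_⟩
  · obtain ⟨j, rfl⟩ := Nat.exists_eq_add_of_le' hn
    exact ⟨_, QuadRat.isCurveOfDegree_closure_trace (QuadRat.polyX_isHomogeneous (j + 1))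
      (QuadRat.polyX_squarefree j) (QuadRat.eval_polyX_ne_zero j)
      (QuadRat.family_mem_X_iff (j + 1)), QuadRat.orbDeg_zero_zero (j + 1)⟩
  · obtain ⟨j, rfl⟩ := Nat.exists_eq_add_of_le' hm
    exact ⟨_, QuadRat.isCurveOfDegree_closure_trace (QuadRat.polyY_isHomogeneous j)
      (QuadRat.polyY_squarefree j) (QuadRat.eval_polyY_ne_zero j)
      (QuadRat.family_mem_Y_iff j), QuadRat.orbDeg_one_two j⟩
  · obtain ⟨j, rfl⟩ := Nat.exists_eq_add_of_le' hn
    have h := QuadRat.mk_mem_closure_trace_iff (QuadRat.polyX_isHomogeneous (j + 1))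
      (QuadRat.eval_polyX_ne_zero j) (QuadRat.family_mem_X_iff (j + 1))
    refine ⟨?_, ?_, ?_⟩
    · rw [h]
      exact QuadRat.eval_polyX_ne_zero j
    · rw [h, QuadRat.eval_polyX]
      simp [QuadRat.formX_zero_one_zero]
    · rw [h, QuadRat.eval_polyX]
      simp [QuadRat.formX_apply_zero_one]
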